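/- Let $m,k,r>0$ be real numbers, let $0=y_0<y_1<\dots<y_n=1$, put $I_1=[y_0,y_1]$ and $I_i=(y_{i-1},y_i]$ for $2\le i\le n$, and let $p_1,\dots,p_n>0$ with $\sum_i p_i=1$. Let $g(x)=x^r(1-x)^k$ and $f(x)=x^r(1-x)^{m+k}$ on $[0,1]$, and $$h(x)=(1-x)^m\,\frac{r-x(m+k+r)}{r-x(k+r)}\qquad\Big(x\in[0,1],\ x\ne\tfrac{r}{r+k}\Big).$$ For indices $1\le j_1\le j_2\le n$ and $y_*\in[0,1]$ let $\phi_1^*=S_1(f)/S_1(g)$ and $\phi_2^*=S_2(f)/S_2(g)$, where for $j_1<j_2$ $$S_1(u)=\sum_{i=2}^{j_1}u(y_{i-1})p_i+\sum_{i=j_1+1}^{j_2-1}u(y_i)p_i+u(y_*)p_{j_2}+\sum_{i=j_2+1}^{n}u(y_{i-1})p_i,$$ $$S_2(u)=\sum_{i=2}^{j_1-1}u(y_{i-1})p_i+\sum_{i=j_1}^{j_2-1}u(y_i)p_i+u(y_*)p_{j_2}+\sum_{i=j_2+1}^{n}u(y_{i-1})p_i,$$ and for $j_1=j_2$ $$S_1(u)=\sum_{i=2}^{n}u(y_{i-1})p_i,\qquad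 S_2(u)=\sum_{i=2}^{j_2-1}u(y_{i-1})p_i+u(y_*)p_{j_2}+\sum_{i=j_2+1}^{n}u(y_{i-1})p_i .$$ **Theorem.** (a) Let $n\ge 3$. There is exactly one triple $(\phi^*,y_*,y_{**})$ of real numbers for which there are $1\le j_1\le j_2\le n$ with $y_{**}\in\bar I_{j_1}$, $y_*\in\bar I_{j_2}$ ($\bar I_i$ is the closure of $I_i$), $$h(y_{**})=\phi^*=h(y_*),\qquad y_{**}<\frac{r}{r+m+k}<\frac{r}{r+k}<y_*,\qquad \phi^*=\min\{\phi_1^*,\phi_2^*\}.$$ Its first component is the infimum: $$\phi^*=\inf_{x_1\in I_1,\dots,x_n\in I_n}\frac{\sum_{i=1}^n x_i^r(1-x_i)^{m+k}p_i}{\sum_{i=1}^n x_i^r(1-x_i)^{k}p_i}.$$ For all indices $j_1\le j_2$ as above, this infimum is attained by the discrete prior $P=\sum_{i=1}^n p_i\,\delta_{\xi_i}$, where $\xi_1=0$ and, for $i\ge2$: $\xi_i=y_{i-1}$ if $i<j_1$ or $i>j_2$; $\xi_i=y_i$ if $j_1<i<j_2$; if $\phi^*=\phi_1^*$, then $\xi_{j_1}=y_{j_1-1}$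 and, when $j_1<j_2$, $\xi_{j_2}=y_*$; if $\phi^*=\phi_2^*\ne\phi_1^*$, then $\xi_{j_1}=\min\{y_{j_1},y_*\}$ and $\xi_{j_2}=y_*$. That is, $P$ is a probability measure with $\xi_i\in\bar I_i$ for all $i$ (so it is a limit of priors that satisfy the interval constraints), $\int g\,dP>0$, and $\int f\,dP\big/\int g\,dP=\phi^*$. (b) In the degenerate cases $n\in\{1,2\}$ the infimum, taken over the points $x_i\in I_i$ at which the denominator is non-zero, is $0=h(1)=h\big(\tfrac{r}{r+m+k}\big)$, and the quotient tends to $0$ along $x_i=0$ $(i<n)$, $x_n\to1^-$. -/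

import Mathlib

open Set Filter Topology MeasureTheory

noncomputable section

namespace CBI

/-- The likelihood `g(x) = x^r (1-x)^k` (real exponents). -/
def g (k r x : ℝ) : ℝ := x ^ r * (1 - x) ^ k

/-- `f(x) = x^r (1-x)^(m+k)`. -/
def f (m k r x : ℝ) : ℝ := x ^ r * (1 - x) ^ (m + k)

/-- The function `h`; it is only used at points `x ≠ r/(r+k)`. -/
def h (m k r x : ℝ) : ℝ :=
  (1 - x) ^ m * ((r - x * (m + k + r)) / (r - x * (k + r)))

/-- The intervals `I_1 = [y_0, y_1]` and `I_i = (y_{i-1}, y_i]` for `i ≥ 2`. -/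
def I (y : ℕ → ℝ) (i : ℕ) : Set ℝ :=
  if i = 1 then Icc (y 0) (y 1) else Ioc (y (i - 1)) (y i)

/-- The denominator `∑_{i=1}^n g(x_i) p_i` of the objective function. -/
def den (k r : ℝ) (n : ℕ) (p x : ℕ → ℝ) : ℝ :=
  ∑ i ∈ Finset.Icc 1 n, g k r (x i) * p i

/-- The numerator `∑_{i=1}^n f(x_i) p_i` of the objective function. -/
def num (m k r : ℝ) (n : ℕ) (p x : ℕ → ℝ) : ℝ :=
  ∑ i ∈ Finset.Icc 1 n, f m k r (x i) * p i

/-- The objective function. -/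
def objective (m k r : ℝ) (n : ℕ) (p x : ℕ → ℝ) : ℝ :=
  num m k r n p x / den k r n p x

/-- All values of the objective function at feasible points `x_i ∈ I_i` at which it is defined.
(For `n ≥ 3` the denominator never vanishes on feasible points, since `x_2 ∈ (0,1)`.) -/
def values (m k r : ℝ) (n : ℕ) (y p : ℕ → ℝ) : Set ℝ :=
  {v | ∃ x : ℕ → ℝ, (∀ i ∈ Finset.Icc 1 n, x i ∈ I y i) ∧ den k r n p x ≠ 0 ∧
    v = objective m k r n p x}

/-- The sum occurring in the numerator (for `u = f`) and denominator (for `u = g`) of the first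
endpoint-placement value; `ys` stands for `y_*`. -/
def S₁ (u : ℝ → ℝ) (n : ℕ) (y p : ℕ → ℝ) (ys : ℝ) (j₁ j₂ : ℕ) : ℝ :=
  if j₁ < j₂ then
    ∑ i ∈ Finset.Icc 2 j₁, u (y (i - 1)) * p i
      + ∑ i ∈ Finset.Icc (j₁ + 1) (j₂ - 1), u (y i) * p i
      + u ys * p j₂
      + ∑ i ∈ Finset.Icc (j₂ + 1) n, u (y (i - 1)) * p i
  else
    ∑ i ∈ Finset.Icc 2 n, u (y (i - 1)) * p i

/-- The same for the second endpoint-placement value. -/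
def S₂ (u : ℝ → ℝ) (n : ℕ) (y p : ℕ → ℝ) (ys : ℝ) (j₁ j₂ : ℕ) : ℝ :=
  if j₁ < j₂ then
    ∑ i ∈ Finset.Icc 2 (j₁ - 1), u (y (i - 1)) * p i
      + ∑ i ∈ Finset.Icc j₁ (j₂ - 1), u (y i) * p i
      + u ys * p j₂
      + ∑ i ∈ Finset.Icc (j₂ + 1) n, u (y (i - 1)) * p i
  else
    ∑ i ∈ Finset.Icc 2 (j₂ - 1), u (y (i - 1)) * p i
      + u ys * p j₂
      + ∑ i ∈ Finset.Icc (j₂ + 1) n, u (y (i - 1)) * p i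

/-- `φ*_1`. -/
def φ₁ (m k r : ℝ) (n : ℕ) (y p : ℕ → ℝ) (ys : ℝ) (j₁ j₂ : ℕ) : ℝ :=
  S₁ (f m k r) n y p ys j₁ j₂ / S₁ (g k r) n y p ys j₁ j₂

/-- `φ*_2`. -/
def φ₂ (m k r : ℝ) (n : ℕ) (y p : ℕ → ℝ) (ys : ℝ) (j₁ j₂ : ℕ) : ℝ :=
  S₂ (f m k r) n y p ys j₁ j₂ / S₂ (g k r) n y p ys j₁ j₂

/-- The fixed-point system for a triple `(φ, ys, yss)`, standing for `(φ*, y_*, y_**)`,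
with interval indices `j₁, j₂`. -/
structure IsFixedPoint (m k r : ℝ) (n : ℕ) (y p : ℕ → ℝ) (φ ys yss : ℝ) (j₁ j₂ : ℕ) : Prop where
  one_le : 1 ≤ j₁
  le : j₁ ≤ j₂
  le_n : j₂ ≤ n
  h_yss : h m k r yss = φ
  h_ys : h m k r ys = φ
  eq_min : φ = min (φ₁ m k r n y p ys j₁ j₂) (φ₂ m k r n y p ys j₁ j₂)
  yss_lt : yss < r / (r + m + k)
  mid_lt : r / (r + m + k) < r / (r + k)
  lt_ys : r / (r + k) < ys
  yss_mem : yss ∈ closure (I y j₁)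
  ys_mem : ys ∈ closure (I y j₂)

/-- The location at which the conservative prior puts the mass `p_i`, `1 ≤ i ≤ n`. -/
def loc (m k r : ℝ) (n : ℕ) (y p : ℕ → ℝ) (φ ys : ℝ) (j₁ j₂ : ℕ) (i : ℕ) : ℝ :=
  if i = 1 then (if n = 1 then 1 else 0)
  else if i < j₁ ∨ j₂ < i then y (i - 1)
  else if j₁ < i ∧ i < j₂ then y i
  else if φ = φ₁ m k r n y p ys j₁ j₂ then
    (if i = j₁ then y (j₁ - 1) else ys)
  else
    (if i = j₁ then min (y j₁) ys else ys)

/-- The conservative prior: the discrete measure `∑_i p_i δ_{loc i}`. -/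
def prior (m k r : ℝ) (n : ℕ) (y p : ℕ → ℝ) (φ ys : ℝ) (j₁ j₂ : ℕ) : Measure ℝ :=
  ∑ i ∈ Finset.Icc 1 n, ENNReal.ofReal (p i) • Measure.dirac (loc m k r n y p φ ys j₁ j₂ i)

end CBI

end

/-!
A number `φ` is the minimum of the objective over the box of closed cells if and only if the least
value of `∑ i, (f - φ g)(x i) p i` over that box is zero. On `[0, 1]` the function `f - φ g` goes
up, down and up again; it turns at the two solutions `y_** < y_*` of `h = φ`. Hence a cell that
contains no turning point has its minimum at a known end, the cell of `y_*` has it at `y_*`, and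
only the cell of `y_**` leaves a choice between two points. The two resulting placements have the
objective values `φ*_1` and `φ*_2`, so the equation `φ = min φ*_1 φ*_2` says exactly that `φ` is the
minimum. Uniqueness follows, since `h` is strictly decreasing on either side.

If `y_**` lies in the first cell, then `φ*_1 ≤ φ*_2`. Indeed `f / g = (1 - x) ^ m` decreases, so for
`φ = φ*_2` the function `f - φ g` cannot be negative at the first point of the second placement: it
would be nonpositive at all later ones, while the weighted sum is zero. Moving the first point to
`0`, where `f - φ g` vanishes, therefore does not increase the objective.
-/

namespace CBI

section FractionalMinimization

variable {α β 𝕜 : Type*}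

lemma isLeast_image_iff_of_subset [PartialOrder β] {F : α → β} {s t : Set α} {c : β} (hts : t ⊆ s)
    (hdom : ∀ x ∈ s, ∃ z ∈ t, F z ≤ F x) : IsLeast (F '' t) c ↔ IsLeast (F '' s) c := by
  have hbounds : lowerBounds (F '' t) = lowerBounds (F '' s) := by
    refine Subset.antisymm (fun b hb => forall_mem_image.2 fun x hx => ?_)
      (lowerBounds_mono_set (image_mono hts))
    obtain ⟨z, hz, hzx⟩ := hdom x hx
    exact (hb (mem_image_of_mem F hz)).trans hzx
  refine ⟨fun h => ⟨image_mono hts h.1, hbounds ▸ h.2⟩, fun h => ⟨?_, hbounds ▸ h.2⟩⟩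
  obtain ⟨x, hx, rfl⟩ := h.1
  obtain ⟨z, hz, hzx⟩ := hdom x hx
  exact ⟨z, hz, hzx.antisymm (h.2 (mem_image_of_mem F (hts hz)))⟩

lemma isLeast_div_image_iff [Field 𝕜] [LinearOrder 𝕜] [IsStrictOrderedRing 𝕜] {N D : α → 𝕜}
    {s : Set α} {c : 𝕜} (hD : ∀ x ∈ s, 0 < D x) :
    IsLeast ((fun x => N x / D x) '' s) c ↔ IsLeast ((fun x => N x - c * D x) '' s) 0 := by
  refine and_congr (exists_congr fun x => and_congr_right fun hx => ?_) ?_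
  · exact (div_eq_iff (hD x hx).ne').trans sub_eq_zero.symm
  · simp only [mem_lowerBounds, forall_mem_image]
    exact forall₂_congr fun x hx => (le_div_iff₀ (hD x hx)).trans sub_nonneg.symm

lemma isGLB_image_of_isLeast_image_closure [TopologicalSpace α] [TopologicalSpace β]
    [LinearOrder β] [OrderTopology β] {F : α → β} {s : Set α} {c : β}
    (hF : ContinuousOn F (closure s)) (hc : IsLeast (F '' closure s) c) : IsGLB (F '' s) c :=
  isGLB_of_mem_closure (lowerBounds_mono_set (image_mono subset_closure) hc.2)
    (hF.image_closure hc.1)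

lemma isCompact_image_pi_of_eqOn {ι X Y : Type*} [TopologicalSpace X] [TopologicalSpace Y]
    {s : Set ι} {t : ι → Set X} (ht : ∀ i ∈ s, IsCompact (t i)) {F : (ι → X) → Y}
    (hF : ContinuousOn F (s.pi t)) (hcongr : ∀ x x', EqOn x x' s → F x = F x') :
    IsCompact (F '' s.pi t) := by
  classical
  obtain hempty | ⟨x₀, -⟩ := (s.pi t).eq_empty_or_nonempty
  · simp only [hempty, image_empty, isCompact_empty]
  -- Only the coordinates in `s` matter, so the others may be frozen at those of `x₀`.
  let K : Set (ι → X) := univ.pi fun i => if i ∈ s then t i else {x₀ i}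
  have hK : IsCompact K := isCompact_univ_pi fun i => by
    split_ifs with hi
    · exact ht i hi
    · exact isCompact_singleton
  have hKs : K ⊆ s.pi t := fun x hx i hi => by simpa only [if_pos hi] using hx i (mem_univ i)
  have himage : F '' s.pi t = F '' K := by
    refine (image_subset_iff.2 fun x hx => ?_).antisymm (image_mono hKs)
    refine ⟨s.piecewise x x₀, fun i _ => ?_, hcongr _ _ (piecewise_eqOn s x x₀)⟩
    by_cases hi : i ∈ s
    · simpa only [piecewise_eq_of_mem _ _ _ hi, if_pos hi] using hx i hi
    · simp only [piecewise_eq_of_notMem _ _ _ hi, if_neg hi, mem_singleton_iff]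
  exact himage ▸ hK.image_of_continuousOn (hF.mono hKs)

end FractionalMinimization

section Likelihood

variable {m k r φ x : ℝ}

lemma f_eq_g (m k r : ℝ) : f m k r = g (m + k) r := rfl

lemma continuous_g (hk : 0 ≤ k) (hr : 0 ≤ r) : Continuous (g k r) :=
  (continuous_id.rpow_const fun _ => Or.inr hr).mul
    ((continuous_const.sub continuous_id).rpow_const fun _ => Or.inr hk)

lemma g_zero (hr : r ≠ 0) : g k r 0 = 0 := by
  rw [g, Real.zero_rpow hr, zero_mul]

lemma g_nonneg (hx : x ∈ Icc (0 : ℝ) 1) : 0 ≤ g k r x :=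
  mul_nonneg (Real.rpow_nonneg hx.1 _) (Real.rpow_nonneg (sub_nonneg.2 hx.2) _)

lemma g_pos (hx : x ∈ Ioo (0 : ℝ) 1) : 0 < g k r x :=
  mul_pos (Real.rpow_pos_of_pos hx.1 _) (Real.rpow_pos_of_pos (sub_pos.2 hx.2) _)

lemma f_eq_rpow_mul_g (hm : 0 ≤ m) (hk : 0 ≤ k) (hx : x ≤ 1) :
    f m k r x = (1 - x) ^ m * g k r x := by
  rw [f, g, Real.rpow_add_of_nonneg (sub_nonneg.2 hx) hm hk, mul_left_comm]

lemma f_le_g (hm : 0 ≤ m) (hk : 0 ≤ k) (hx : x ∈ Icc (0 : ℝ) 1) : f m k r x ≤ g k r x := by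
  rw [f_eq_rpow_mul_g hm hk hx.2]
  exact mul_le_of_le_one_left (g_nonneg hx)
    (Real.rpow_le_one (sub_nonneg.2 hx.2) (sub_le_self 1 hx.1) hm)

lemma f_lt_g (hm : 0 < m) (hk : 0 ≤ k) (hx : x ∈ Ioo (0 : ℝ) 1) : f m k r x < g k r x := by
  rw [f_eq_rpow_mul_g hm.le hk hx.2.le]
  exact mul_lt_of_lt_one_left (g_pos hx)
    (Real.rpow_lt_one (sub_nonneg.2 hx.2.le) (sub_lt_self 1 hx.1) hm)

lemma hasDerivAt_g (hx : x ∈ Ioo (0 : ℝ) 1) :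
    HasDerivAt (g k r) (x ^ (r - 1) * (1 - x) ^ (k - 1) * (r - x * (k + r))) x := by
  have hx1 : 1 - x ≠ 0 := (sub_pos.2 hx.2).ne'
  have hleft : HasDerivAt (fun z : ℝ => z ^ r) (1 * r * x ^ (r - 1)) x :=
    (hasDerivAt_id x).rpow_const (Or.inl hx.1.ne')
  have hright : HasDerivAt (fun z : ℝ => (1 - z) ^ k) (-1 * k * (1 - x) ^ (k - 1)) x :=
    ((hasDerivAt_id x).const_sub 1).rpow_const (Or.inl hx1)
  refine (hleft.mul hright).congr_deriv ?_
  rw [Real.rpow_sub_one hx.1.ne', Real.rpow_sub_one hx1]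
  field_simp [hx.1.ne']
  ring

/-- The function `f - φ g`. Its weighted sums are the numerator minus `φ` times the denominator of
the objective function, so they are nonnegative exactly where the objective is at least `φ`. -/
noncomputable def excess (m k r φ x : ℝ) : ℝ := f m k r x - φ * g k r x

lemma continuous_excess (hm : 0 ≤ m) (hk : 0 ≤ k) (hr : 0 ≤ r) : Continuous (excess m k r φ) :=
  (continuous_g (add_nonneg hm hk) hr).sub (continuous_const.mul (continuous_g hk hr))

lemma excess_zero (hr : r ≠ 0) : excess m k r φ 0 = 0 := by
  rw [excess, f_eq_g, g_zero hr, g_zero hr, mul_zero, sub_zero]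

lemma excess_eq_mul_g (hm : 0 ≤ m) (hk : 0 ≤ k) (hx : x ≤ 1) :
    excess m k r φ x = ((1 - x) ^ m - φ) * g k r x := by
  rw [excess, f_eq_rpow_mul_g hm hk hx, sub_mul]

lemma excess_nonpos_of_neg {c : ℝ} (hm : 0 ≤ m) (hk : 0 ≤ k) (hc : 0 ≤ c) (hcx : c ≤ x)
    (hx : x ≤ 1) (hneg : excess m k r φ c < 0) : excess m k r φ x ≤ 0 := by
  have hc1 : c ≤ 1 := hcx.trans hx
  rw [excess_eq_mul_g hm hk hc1] at hneg
  rw [excess_eq_mul_g hm hk hx]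
  have hφ : (1 - c) ^ m < φ := sub_neg.1 (neg_of_mul_neg_left hneg (g_nonneg ⟨hc, hc1⟩))
  have hanti : (1 - x) ^ m ≤ (1 - c) ^ m :=
    Real.rpow_le_rpow (sub_nonneg.2 hx) (sub_le_sub_left hcx 1) hm
  exact mul_nonpos_of_nonpos_of_nonneg (sub_nonpos.2 (hanti.trans hφ.le))
    (g_nonneg ⟨hc.trans hcx, hx⟩)

/-- The quotient of the derivative of `excess m k r φ` by the positive factor
`x ^ (r - 1) * (1 - x) ^ (k - 1)`. It carries the sign of that derivative on `(0, 1)`. -/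
noncomputable def derivFactor (m k r φ x : ℝ) : ℝ :=
  (1 - x) ^ m * (r - x * (m + k + r)) - φ * (r - x * (k + r))

lemma continuous_derivFactor (hm : 0 ≤ m) : Continuous (derivFactor m k r φ) :=
  (((continuous_const.sub continuous_id).rpow_const fun _ => Or.inr hm).mul (by fun_prop)).sub
    (by fun_prop)

lemma hasDerivAt_excess (hx : x ∈ Ioo (0 : ℝ) 1) :
    HasDerivAt (excess m k r φ) (x ^ (r - 1) * (1 - x) ^ (k - 1) * derivFactor m k r φ x) x := by
  refine ((hasDerivAt_g (k := m + k) hx).sub ((hasDerivAt_g hx).const_mul φ)).congr_deriv ?_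
  rw [add_sub_assoc, Real.rpow_add (sub_pos.2 hx.2), derivFactor]
  ring

lemma monotoneOn_excess {a b : ℝ} (hm : 0 ≤ m) (hk : 0 ≤ k) (hr : 0 ≤ r) (ha : 0 ≤ a) (hb : b ≤ 1)
    (h : ∀ x ∈ Ioo a b, 0 ≤ derivFactor m k r φ x) : MonotoneOn (excess m k r φ) (Icc a b) := by
  have hsub : Ioo a b ⊆ Ioo 0 1 := Ioo_subset_Ioo ha hb
  refine monotoneOn_of_hasDerivWithinAt_nonneg (convex_Icc a b)
    (continuous_excess hm hk hr).continuousOn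
    (f' := fun x => x ^ (r - 1) * (1 - x) ^ (k - 1) * derivFactor m k r φ x) ?_ ?_ <;>
    rw [interior_Icc] <;> intro x hx
  · exact (hasDerivAt_excess (hsub hx)).hasDerivWithinAt
  · exact mul_nonneg (g_nonneg (Ioo_subset_Icc_self (hsub hx))) (h x hx)

lemma antitoneOn_excess {a b : ℝ} (hm : 0 ≤ m) (hk : 0 ≤ k) (hr : 0 ≤ r) (ha : 0 ≤ a) (hb : b ≤ 1)
    (h : ∀ x ∈ Ioo a b, derivFactor m k r φ x ≤ 0) : AntitoneOn (excess m k r φ) (Icc a b) := by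
  have hsub : Ioo a b ⊆ Ioo 0 1 := Ioo_subset_Ioo ha hb
  refine antitoneOn_of_hasDerivWithinAt_nonpos (convex_Icc a b)
    (continuous_excess hm hk hr).continuousOn
    (f' := fun x => x ^ (r - 1) * (1 - x) ^ (k - 1) * derivFactor m k r φ x) ?_ ?_ <;>
    rw [interior_Icc] <;> intro x hx
  · exact (hasDerivAt_excess (hsub hx)).hasDerivWithinAt
  · exact mul_nonpos_of_nonneg_of_nonpos (g_nonneg (Ioo_subset_Icc_self (hsub hx))) (h x hx)

end Likelihood

section CriticalPoints

variable {m k r φ ys yss x : ℝ}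

lemma sub_mul_add_pos_iff (hkr : 0 < k + r) : 0 < r - x * (k + r) ↔ x < r / (r + k) := by
  rw [sub_pos, add_comm r k, lt_div_iff₀ hkr]

lemma sub_mul_add_neg_iff (hkr : 0 < k + r) : r - x * (k + r) < 0 ↔ r / (r + k) < x := by
  rw [sub_neg, add_comm r k, div_lt_iff₀ hkr]

lemma sub_div_mul_add (hrk : r + k ≠ 0) : r - r / (r + k) * (k + r) = 0 := by
  rw [add_comm k r, div_mul_cancel₀ r hrk, sub_self]

lemma div_add_add_lt_div_add (hm : 0 < m) (hk : 0 ≤ k) (hr : 0 < r) :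
    r / (r + m + k) < r / (r + k) :=
  div_lt_div_of_pos_left hr (by positivity) (by linarith)

lemma derivFactor_eq_mul_h_sub (hx : r - x * (k + r) ≠ 0) :
    derivFactor m k r φ x = (r - x * (k + r)) * (h m k r x - φ) := by
  rw [derivFactor, h]
  field_simp

lemma h_lt_h {x' : ℝ} (hm : 0 < m) (hr : 0 < r) (hlt : x < x') (hx' : x' ≤ 1)
    (hside : 0 < (r - x * (k + r)) * (r - x' * (k + r)))
    (hnonneg : 0 ≤ (r - x' * (m + k + r)) / (r - x' * (k + r))) :
    h m k r x' < h m k r x := by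
  have hratio : (r - x' * (m + k + r)) / (r - x' * (k + r))
      < (r - x * (m + k + r)) / (r - x * (k + r)) := by
    rw [← sub_pos, div_sub_div _ _ (left_ne_zero_of_mul hside.ne')
      (right_ne_zero_of_mul hside.ne')]
    refine div_pos ?_ hside
    have : 0 < r * m * (x' - x) := mul_pos (mul_pos hr hm) (sub_pos.2 hlt)
    linarith
  have hrpow : (1 - x') ^ m ≤ (1 - x) ^ m :=
    Real.rpow_le_rpow (by linarith) (by linarith) hm.le
  exact (mul_le_mul_of_nonneg_right hrpow hnonneg).trans_lt
    (mul_lt_mul_of_pos_left hratio (Real.rpow_pos_of_pos (by linarith) _))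

lemma ratio_pos_of_lt (hm : 0 < m) (hk : 0 ≤ k) (hr : 0 < r) (hx : x < r / (r + m + k)) :
    0 < (r - x * (m + k + r)) / (r - x * (k + r)) :=
  div_pos ((sub_mul_add_pos_iff (by positivity)).2 (by rwa [← add_assoc]))
    ((sub_mul_add_pos_iff (by positivity)).2 (hx.trans (div_add_add_lt_div_add hm hk hr)))

lemma div_add_add_le_one (hm : 0 ≤ m) (hk : 0 ≤ k) (hr : 0 < r) : r / (r + m + k) ≤ 1 :=
  (div_le_one (by positivity)).2 (by linarith)

lemma strictAntiOn_h_left (hm : 0 < m) (hk : 0 ≤ k) (hr : 0 < r) :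
    StrictAntiOn (h m k r) (Iio (r / (r + m + k))) := by
  intro x hx x' hx' hlt
  have hpos {z : ℝ} (hz : z < r / (r + m + k)) : 0 < r - z * (k + r) :=
    (sub_mul_add_pos_iff (by positivity)).2 (hz.trans (div_add_add_lt_div_add hm hk hr))
  exact h_lt_h hm hr hlt ((mem_Iio.1 hx').le.trans (div_add_add_le_one hm.le hk hr))
    (mul_pos (hpos hx) (hpos hx')) (ratio_pos_of_lt hm hk hr hx').le

lemma strictAntiOn_h_right (hm : 0 < m) (hk : 0 ≤ k) (hr : 0 < r) :
    StrictAntiOn (h m k r) (Ioc (r / (r + k)) 1) := by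
  intro x hx x' hx' hlt
  have hneg {z : ℝ} (hz : r / (r + k) < z) : r - z * (k + r) < 0 :=
    (sub_mul_add_neg_iff (by positivity)).2 hz
  have hx'0 : 0 < x' := (by positivity : 0 < r / (r + k)).trans hx'.1
  have hnum : r - x' * (m + k + r) ≤ 0 := by nlinarith [hneg hx'.1]
  exact h_lt_h hm hr hlt hx'.2 (mul_pos_of_neg_of_neg (hneg hx.1) (hneg hx'.1))
    (div_nonneg_of_nonpos hnum (hneg hx'.1).le)

lemma h_pos_of_lt (hm : 0 < m) (hk : 0 ≤ k) (hr : 0 < r) (hx : x < r / (r + m + k)) :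
    0 < h m k r x :=
  mul_pos (Real.rpow_pos_of_pos (sub_pos.2 (hx.trans_le (div_add_add_le_one hm.le hk hr))) _)
    (ratio_pos_of_lt hm hk hr hx)

lemma h_div_add_add (h0 : r + m + k ≠ 0) : h m k r (r / (r + m + k)) = 0 := by
  rw [add_assoc] at h0 ⊢
  rw [h, sub_div_mul_add h0, zero_div, mul_zero]

lemma h_one (hm : m ≠ 0) : h m k r 1 = 0 := by
  rw [h, sub_self, Real.zero_rpow hm, zero_mul]

/-- The critical points `yss` and `ys` of `f - φ g`, one on either side of the interval from
`r / (r + m + k)` to `r / (r + k)` on which no critical point lies. -/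
structure IsCriticalPair (m k r φ ys yss : ℝ) : Prop where
  nonneg : 0 ≤ yss
  le_one : ys ≤ 1
  h_yss : h m k r yss = φ
  h_ys : h m k r ys = φ
  yss_lt : yss < r / (r + m + k)
  lt_ys : r / (r + k) < ys

lemma exists_isCriticalPair (hm : 0 < m) (hk : 0 < k) (hr : 0 < r) (hφ : φ ∈ Ioo (0 : ℝ) 1) :
    ∃ ys yss, IsCriticalPair m k r φ ys yss := by
  have ha : 0 < r / (r + m + k) := by positivity
  have hab := div_add_add_lt_div_add hm hk.le hr
  have hb : r / (r + k) < 1 := (div_lt_one (by positivity)).2 (by linarith)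
  have at_zero : 0 < derivFactor m k r φ 0 := by
    simp only [derivFactor, sub_zero, Real.one_rpow, zero_mul]
    nlinarith [hφ.2]
  have at_left : derivFactor m k r φ (r / (r + m + k)) < 0 := by
    have hpos := (sub_mul_add_pos_iff (by positivity)).2 hab
    rw [derivFactor_eq_mul_h_sub hpos.ne', h_div_add_add (by positivity), zero_sub]
    exact mul_neg_of_pos_of_neg hpos (neg_neg_of_pos hφ.1)
  have at_right : derivFactor m k r φ (r / (r + k)) < 0 := by
    have hneg : r - r / (r + k) * (m + k + r) < 0 :=
      (sub_mul_add_neg_iff (by positivity)).2 (by rwa [← add_assoc])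
    rw [derivFactor, sub_div_mul_add (by positivity), mul_zero, sub_zero]
    exact mul_neg_of_pos_of_neg (Real.rpow_pos_of_pos (sub_pos.2 hb) _) hneg
  have at_one : 0 < derivFactor m k r φ 1 := by
    simp only [derivFactor, sub_self, Real.zero_rpow hm.ne', zero_mul]
    linarith [mul_pos hφ.1 hk]
  have hcont := continuous_derivFactor (k := k) (r := r) (φ := φ) hm.le
  obtain ⟨yss, hyss, zero_yss⟩ :=
    intermediate_value_Ioo' ha.le hcont.continuousOn ⟨at_left, at_zero⟩
  obtain ⟨ys, hys, zero_ys⟩ := intermediate_value_Ioo hb.le hcont.continuousOn ⟨at_right, at_one⟩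
  have h_eq {x : ℝ} (hx : r - x * (k + r) ≠ 0) (hzero : derivFactor m k r φ x = 0) :
      h m k r x = φ := by
    rw [derivFactor_eq_mul_h_sub hx] at hzero
    exact sub_eq_zero.1 ((mul_eq_zero_iff_left hx).1 hzero)
  exact ⟨ys, yss, hyss.1.le, hys.2.le,
    h_eq ((sub_mul_add_pos_iff (by positivity)).2 (hyss.2.trans hab)).ne' zero_yss,
    h_eq ((sub_mul_add_neg_iff (by positivity)).2 hys.1).ne zero_ys, hyss.2, hys.1⟩

/-- `G` increases on `[0, a]`, decreases on `[a, b]` and increases again on `[b, 1]`, which is all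
that the choice of the optimal placement needs to know about `f - φ g`. -/
structure UpDownUp (G : ℝ → ℝ) (a b : ℝ) : Prop where
  monotoneOn_left : MonotoneOn G (Icc 0 a)
  antitoneOn_mid : AntitoneOn G (Icc a b)
  monotoneOn_right : MonotoneOn G (Icc b 1)

lemma UpDownUp.apply_right_le {G : ℝ → ℝ} {a b : ℝ} (hG : UpDownUp G a b) (hb : b ≤ 1)
    (hx : x ∈ Icc a 1) : G b ≤ G x := by
  rcases le_total x b with hxb | hbx
  · exact hG.antitoneOn_mid ⟨hx.1, hxb⟩ ⟨hx.1.trans hxb, le_rfl⟩ hxb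
  · exact hG.monotoneOn_right ⟨le_rfl, hb⟩ ⟨hbx, hx.2⟩ hbx

namespace IsCriticalPair

lemma lt (hc : IsCriticalPair m k r φ ys yss) (hm : 0 < m) (hk : 0 ≤ k) (hr : 0 < r) :
    yss < ys :=
  hc.yss_lt.trans ((div_add_add_lt_div_add hm hk hr).trans hc.lt_ys)

lemma unique (hc : IsCriticalPair m k r φ ys yss) {ys' yss' : ℝ}
    (hc' : IsCriticalPair m k r φ ys' yss') (hm : 0 < m) (hk : 0 ≤ k) (hr : 0 < r) :
    ys' = ys ∧ yss' = yss :=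
  ⟨(strictAntiOn_h_right hm hk hr).injOn ⟨hc'.lt_ys, hc'.le_one⟩ ⟨hc.lt_ys, hc.le_one⟩
      (hc'.h_ys.trans hc.h_ys.symm),
    (strictAntiOn_h_left hm hk hr).injOn hc'.yss_lt hc.yss_lt (hc'.h_yss.trans hc.h_yss.symm)⟩

lemma derivFactor_nonneg_left (hc : IsCriticalPair m k r φ ys yss) (hm : 0 < m) (hk : 0 ≤ k)
    (hr : 0 < r) (hx : x < yss) : 0 ≤ derivFactor m k r φ x := by
  have hxa := hx.trans hc.yss_lt
  have hpos := (sub_mul_add_pos_iff (by positivity)).2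
    (hxa.trans (div_add_add_lt_div_add hm hk hr))
  have hh : φ < h m k r x := hc.h_yss ▸ strictAntiOn_h_left hm hk hr hxa hc.yss_lt hx
  rw [derivFactor_eq_mul_h_sub hpos.ne']
  exact mul_nonneg hpos.le (sub_nonneg.2 hh.le)

lemma derivFactor_nonneg_right (hc : IsCriticalPair m k r φ ys yss) (hm : 0 < m) (hk : 0 ≤ k)
    (hr : 0 < r) (hx : x ∈ Ioc ys 1) : 0 ≤ derivFactor m k r φ x := by
  have hbx := hc.lt_ys.trans hx.1
  have hneg := (sub_mul_add_neg_iff (by positivity)).2 hbx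
  have hh : h m k r x < φ :=
    hc.h_ys ▸ strictAntiOn_h_right hm hk hr ⟨hc.lt_ys, hc.le_one⟩ ⟨hbx, hx.2⟩ hx.1
  rw [derivFactor_eq_mul_h_sub hneg.ne]
  exact mul_nonneg_of_nonpos_of_nonpos hneg.le (sub_nonpos.2 hh.le)

lemma derivFactor_nonpos_mid (hc : IsCriticalPair m k r φ ys yss) (hm : 0 < m) (hk : 0 ≤ k)
    (hr : 0 < r) (hx : x ∈ Ioo yss ys) : derivFactor m k r φ x ≤ 0 := by
  have hsum : 0 < k + r := by positivity
  rcases lt_or_ge x (r / (r + m + k)) with hxa | hax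
  · have hpos := (sub_mul_add_pos_iff hsum).2 (hxa.trans (div_add_add_lt_div_add hm hk hr))
    have hh : h m k r x < φ := hc.h_yss ▸ strictAntiOn_h_left hm hk hr hc.yss_lt hxa hx.1
    rw [derivFactor_eq_mul_h_sub hpos.ne']
    exact mul_nonpos_of_nonneg_of_nonpos hpos.le (sub_nonpos.2 hh.le)
  rcases le_or_gt x (r / (r + k)) with hxb | hbx
  · have hf : r - x * (m + k + r) ≤ 0 :=
      not_lt.1 fun hlt => hax.not_gt (by
        rwa [sub_mul_add_pos_iff (by positivity), ← add_assoc] at hlt)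
    have hg : 0 ≤ r - x * (k + r) :=
      not_lt.1 fun hlt => hxb.not_gt ((sub_mul_add_neg_iff hsum).1 hlt)
    have hφ : 0 < φ := hc.h_yss ▸ h_pos_of_lt hm hk hr hc.yss_lt
    exact sub_nonpos.2 ((mul_nonpos_of_nonneg_of_nonpos
      (Real.rpow_nonneg (sub_nonneg.2 (hx.2.le.trans hc.le_one)) _) hf).trans
      (mul_nonneg hφ.le hg))
  · have hneg := (sub_mul_add_neg_iff hsum).2 hbx
    have hh : φ < h m k r x := hc.h_ys ▸ strictAntiOn_h_right hm hk hr
      ⟨hbx, hx.2.le.trans hc.le_one⟩ ⟨hc.lt_ys, hc.le_one⟩ hx.2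
    rw [derivFactor_eq_mul_h_sub hneg.ne]
    exact mul_nonpos_of_nonpos_of_nonneg hneg.le (sub_nonneg.2 hh.le)

lemma upDownUp_excess (hc : IsCriticalPair m k r φ ys yss) (hm : 0 < m) (hk : 0 ≤ k)
    (hr : 0 < r) : UpDownUp (excess m k r φ) yss ys := by
  have hlt := hc.lt hm hk hr
  refine ⟨monotoneOn_excess hm.le hk hr.le le_rfl (hlt.le.trans hc.le_one) fun x hx => ?_,
    antitoneOn_excess hm.le hk hr.le hc.nonneg hc.le_one fun x hx => ?_,
    monotoneOn_excess hm.le hk hr.le (hc.nonneg.trans hlt.le) le_rfl fun x hx => ?_⟩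
  · exact hc.derivFactor_nonneg_left hm hk hr hx.2
  · exact hc.derivFactor_nonpos_mid hm hk hr hx
  · exact hc.derivFactor_nonneg_right hm hk hr ⟨hx.1, hx.2.le⟩

end IsCriticalPair

end CriticalPoints

section Partition

variable {n : ℕ} {y x : ℕ → ℝ}

/-- A partition `0 = y 0 < ⋯ < y n = 1` of the unit interval. The sequence is total, and its values
beyond `n` are irrelevant. -/
structure IsPartition (n : ℕ) (y : ℕ → ℝ) : Prop where
  zero : y 0 = 0
  last : y n = 1
  strictMonoOn : StrictMonoOn y (Iic n)

/-- The points whose coordinates `1, …, n` lie in the closed cells of a partition; the other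
coordinates are unrestricted. -/
def box (n : ℕ) (y : ℕ → ℝ) : Set (ℕ → ℝ) :=
  (Finset.Icc 1 n : Set ℕ).pi fun i => Icc (y (i - 1)) (y i)

lemma exists_mem_Icc_sub_one {α : Type*} [LinearOrder α] {y : ℕ → α} {t : α} (hn : 1 ≤ n)
    (h0 : y 0 ≤ t) (ht : t ≤ y n) : ∃ j ∈ Finset.Icc 1 n, t ∈ Icc (y (j - 1)) (y j) := by
  induction n, hn using Nat.le_induction with
  | base => exact ⟨1, Finset.mem_Icc.2 ⟨le_rfl, le_rfl⟩, h0, ht⟩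
  | succ n _ ih =>
    rcases le_total t (y n) with hle | hge
    · obtain ⟨j, hj, htj⟩ := ih hle
      exact ⟨j, Finset.Icc_subset_Icc_right n.le_succ hj, htj⟩
    · exact ⟨n + 1, Finset.mem_Icc.2 ⟨n.succ_pos, le_rfl⟩, hge, ht⟩

namespace IsPartition

lemma le_of_le (hy : IsPartition n y) {i j : ℕ} (hij : i ≤ j) (hj : j ≤ n) : y i ≤ y j :=
  hy.strictMonoOn.monotoneOn (mem_Iic.2 (hij.trans hj)) (mem_Iic.2 hj) hij

lemma lt_of_lt (hy : IsPartition n y) {i j : ℕ} (hij : i < j) (hj : j ≤ n) : y i < y j :=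
  hy.strictMonoOn (mem_Iic.2 (hij.le.trans hj)) (mem_Iic.2 hj) hij

lemma pos (hy : IsPartition n y) : 0 < n := by
  refine Nat.pos_of_ne_zero fun hn => zero_ne_one (α := ℝ) ?_
  rw [← hy.zero, ← hy.last, hn]

lemma mem_unit (hy : IsPartition n y) {i : ℕ} (hi : i ≤ n) : y i ∈ Icc (0 : ℝ) 1 :=
  ⟨hy.zero ▸ hy.le_of_le i.zero_le hi, hy.last ▸ hy.le_of_le hi le_rfl⟩

lemma closure_I (hy : IsPartition n y) {i : ℕ} (hi : i ∈ Finset.Icc 1 n) :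
    closure (I y i) = Icc (y (i - 1)) (y i) := by
  rw [Finset.mem_Icc] at hi
  unfold I
  split_ifs with h1
  · subst h1
    exact closure_Icc _ _
  · exact closure_Ioc (hy.lt_of_lt (by lia) hi.2).ne

lemma closure_pi_I (hy : IsPartition n y) :
    closure ((Finset.Icc 1 n : Set ℕ).pi (I y)) = box n y :=
  (closure_pi_set _ _).trans (Set.pi_congr rfl fun _ hi => hy.closure_I hi)

lemma mem_box (hy : IsPartition n y) : y ∈ box n y := fun i hi =>
  ⟨hy.le_of_le (i.sub_le 1) (Finset.mem_Icc.1 hi).2, le_rfl⟩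

lemma mem_unit_of_mem_box (hy : IsPartition n y) (hx : x ∈ box n y) {i : ℕ}
    (hi : i ∈ Finset.Icc 1 n) : x i ∈ Icc (0 : ℝ) 1 := by
  have hin := (Finset.mem_Icc.1 hi).2
  exact Icc_subset_Icc (hy.mem_unit ((i.sub_le 1).trans hin)).1 (hy.mem_unit hin).2 (hx i hi)

lemma mem_Ioo_of_mem_box (hy : IsPartition n y) (hx : x ∈ box n y) {i : ℕ} (h1i : 1 < i)
    (hin : i < n) : x i ∈ Ioo (0 : ℝ) 1 := by
  have hi := hx i (Finset.mem_Icc.2 ⟨h1i.le, hin.le⟩)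
  exact ⟨(hy.zero ▸ hy.lt_of_lt (Nat.sub_pos_of_lt h1i) (by lia)).trans_le hi.1,
    hi.2.trans_lt (hy.last ▸ hy.lt_of_lt hin le_rfl)⟩

lemma apply_le_apply_of_mem_box (hy : IsPartition n y) (hx : x ∈ box n y) {i j : ℕ} (hi : 1 ≤ i)
    (hij : i ≤ j) (hj : j ≤ n) : x i ≤ x j := by
  rcases hij.eq_or_lt with rfl | hlt
  · rfl
  · calc x i ≤ y i := (hx i (Finset.mem_Icc.2 ⟨hi, hij.trans hj⟩)).2
      _ ≤ y (j - 1) := hy.le_of_le (by lia) (by lia)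
      _ ≤ x j := (hx j (Finset.mem_Icc.2 ⟨hi.trans hij, hj⟩)).1

end IsPartition

end Partition

section Objective

variable {m k r φ : ℝ} {n : ℕ} {y p x : ℕ → ℝ}

lemma num_eq_den (m k r : ℝ) (n : ℕ) (p : ℕ → ℝ) : num m k r n p = den (m + k) r n p := rfl

lemma sum_comp_mul_pos {u : ℝ → ℝ} (hu : ∀ t ∈ Icc (0 : ℝ) 1, 0 ≤ u t)
    (hu' : ∀ t ∈ Ioo (0 : ℝ) 1, 0 < u t) (hy : IsPartition n y)
    (hp : ∀ i ∈ Finset.Icc 1 n, 0 < p i) (hn : 3 ≤ n) (hx : x ∈ box n y) :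
    0 < ∑ i ∈ Finset.Icc 1 n, u (x i) * p i := by
  have h2 : 2 ∈ Finset.Icc 1 n := Finset.mem_Icc.2 ⟨one_le_two, by lia⟩
  exact Finset.sum_pos' (fun i hi => mul_nonneg (hu _ (hy.mem_unit_of_mem_box hx hi)) (hp i hi).le)
    ⟨2, h2, mul_pos (hu' _ (hy.mem_Ioo_of_mem_box hx one_lt_two hn)) (hp 2 h2)⟩

lemma den_pos (hy : IsPartition n y) (hp : ∀ i ∈ Finset.Icc 1 n, 0 < p i) (hn : 3 ≤ n)
    (hx : x ∈ box n y) : 0 < den k r n p x :=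
  sum_comp_mul_pos (fun _ => g_nonneg) (fun _ => g_pos) hy hp hn hx

lemma num_lt_den (hm : 0 < m) (hk : 0 ≤ k) (hy : IsPartition n y)
    (hp : ∀ i ∈ Finset.Icc 1 n, 0 < p i) (hn : 3 ≤ n) (hx : x ∈ box n y) :
    num m k r n p x < den k r n p x := by
  have hpos := sum_comp_mul_pos (u := fun t => g k r t - f m k r t)
    (fun _ ht => sub_nonneg.2 (f_le_g hm.le hk ht)) (fun _ ht => sub_pos.2 (f_lt_g hm hk ht))
    hy hp hn hx
  simp only [sub_mul, Finset.sum_sub_distrib] at hpos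
  exact sub_pos.1 hpos

lemma objective_mem_Ioo (hm : 0 < m) (hk : 0 ≤ k) (hy : IsPartition n y)
    (hp : ∀ i ∈ Finset.Icc 1 n, 0 < p i) (hn : 3 ≤ n) (hx : x ∈ box n y) :
    objective m k r n p x ∈ Ioo 0 1 :=
  have hden : 0 < den k r n p x := den_pos hy hp hn hx
  ⟨div_pos (num_eq_den m k r n p ▸ den_pos hy hp hn hx) hden,
    (div_lt_one hden).2 (num_lt_den hm hk hy hp hn hx)⟩

lemma continuous_den (hk : 0 ≤ k) (hr : 0 ≤ r) : Continuous (den k r n p) :=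
  continuous_finsetSum _ fun i _ =>
    ((continuous_g hk hr).comp (continuous_apply i)).mul continuous_const

lemma continuousOn_objective (hm : 0 ≤ m) (hk : 0 ≤ k) (hr : 0 ≤ r) (hy : IsPartition n y)
    (hp : ∀ i ∈ Finset.Icc 1 n, 0 < p i) (hn : 3 ≤ n) :
    ContinuousOn (objective m k r n p) (box n y) :=
  (num_eq_den m k r n p ▸ continuous_den (add_nonneg hm hk) hr).continuousOn.div
    (continuous_den hk hr).continuousOn fun _ hx => (den_pos hy hp hn hx).ne'

lemma objective_congr {x' : ℕ → ℝ} (hxx' : EqOn x x' (Finset.Icc 1 n)) :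
    objective m k r n p x = objective m k r n p x' := by
  have hden (k' : ℝ) : den k' r n p x = den k' r n p x' :=
    Finset.sum_congr rfl fun i hi => by rw [hxx' hi]
  rw [objective, objective, num_eq_den, hden, hden]

lemma exists_isLeast_objective_box (hm : 0 ≤ m) (hk : 0 ≤ k) (hr : 0 ≤ r) (hy : IsPartition n y)
    (hp : ∀ i ∈ Finset.Icc 1 n, 0 < p i) (hn : 3 ≤ n) :
    ∃ φ, IsLeast (objective m k r n p '' box n y) φ :=
  (isCompact_image_pi_of_eqOn (fun _ _ => isCompact_Icc) (continuousOn_objective hm hk hr hy hp hn)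
    fun _ _ => objective_congr).exists_isLeast ⟨_, mem_image_of_mem _ hy.mem_box⟩

lemma values_eq_image (hy : IsPartition n y) (hp : ∀ i ∈ Finset.Icc 1 n, 0 < p i) (hn : 3 ≤ n) :
    values m k r n y p = objective m k r n p '' (Finset.Icc 1 n : Set ℕ).pi (I y) := by
  ext v
  constructor
  · rintro ⟨x, hx, -, rfl⟩
    exact mem_image_of_mem _ hx
  · rintro ⟨x, hx, rfl⟩
    exact ⟨x, hx, (den_pos hy hp hn (hy.closure_pi_I ▸ subset_closure hx)).ne', rfl⟩

lemma isGLB_values (hm : 0 ≤ m) (hk : 0 ≤ k) (hr : 0 ≤ r) (hy : IsPartition n y)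
    (hp : ∀ i ∈ Finset.Icc 1 n, 0 < p i) (hn : 3 ≤ n)
    (hφ : IsLeast (objective m k r n p '' box n y) φ) : IsGLB (values m k r n y p) φ := by
  rw [values_eq_image hy hp hn]
  rw [← hy.closure_pi_I] at hφ
  exact isGLB_image_of_isLeast_image_closure
    (hy.closure_pi_I ▸ continuousOn_objective hm hk hr hy hp hn) hφ

lemma sum_excess (m k r φ : ℝ) (n : ℕ) (p x : ℕ → ℝ) :
    ∑ i ∈ Finset.Icc 1 n, excess m k r φ (x i) * p i = num m k r n p x - φ * den k r n p x := by
  simp only [excess, sub_mul, Finset.sum_sub_distrib, num, den, Finset.mul_sum, mul_assoc]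

lemma excess_first_nonneg (hm : 0 ≤ m) (hk : 0 ≤ k) (hy : IsPartition n y)
    (hp : ∀ i ∈ Finset.Icc 1 n, 0 < p i) (hx : x ∈ box n y)
    (hsum : 0 ≤ ∑ i ∈ Finset.Icc 1 n, excess m k r φ (x i) * p i) :
    0 ≤ excess m k r φ (x 1) := by
  have h1 : 1 ∈ Finset.Icc 1 n := Finset.mem_Icc.2 ⟨le_rfl, hy.pos⟩
  by_contra! hneg
  have hnonpos (i : ℕ) (hi : i ∈ Finset.Icc 1 n) : excess m k r φ (x i) ≤ 0 :=
    excess_nonpos_of_neg hm hk (hy.mem_unit_of_mem_box hx h1).1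
      (hy.apply_le_apply_of_mem_box hx le_rfl (Finset.mem_Icc.1 hi).1 (Finset.mem_Icc.1 hi).2)
      (hy.mem_unit_of_mem_box hx hi).2 hneg
  exact hsum.not_gt (Finset.sum_neg'
    (fun i hi => mul_nonpos_of_nonpos_of_nonneg (hnonpos i hi) (hp i hi).le)
    ⟨1, h1, mul_neg_of_neg_of_pos hneg (hp 1 h1)⟩)

end Objective

section Placement

variable {G u : ℝ → ℝ} {ys yss t : ℝ} {n : ℕ} {y p x : ℕ → ℝ} {a b j₁ j₂ : ℕ}

/-- The `i`-th point is put at the left end of its cell for `i ≤ a` and for `b < i`, at the right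
end for `a < i < b`, and at `t` for `a < i = b`. For `t = y_*` and `b = j₂`, the objective at this
placement is `φ*_1` when `a = j₁` and `φ*_2` when `a = j₁ - 1`. -/
def placement (y : ℕ → ℝ) (t : ℝ) (a b i : ℕ) : ℝ :=
  if i ≤ a ∨ b < i then y (i - 1) else if i < b then y i else t

lemma placement_of_le {i : ℕ} (hi : i ≤ a) : placement y t a b i = y (i - 1) :=
  if_pos (Or.inl hi)

lemma placement_of_gt {i : ℕ} (hi : b < i) : placement y t a b i = y (i - 1) :=
  if_pos (Or.inr hi)

lemma placement_of_lt_of_lt {i : ℕ} (hai : a < i) (hib : i < b) : placement y t a b i = y i := by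
  rw [placement, if_neg (by lia), if_pos hib]

lemma placement_self (hab : a < b) : placement y t a b b = t := by
  rw [placement, if_neg (by lia), if_neg (lt_irrefl b)]

lemma sum_Icc_one_add_sum_Icc {M : Type*} [AddCommMonoid M] (v : ℕ → M) (hab : a ≤ b) :
    ∑ i ∈ Finset.Icc 1 a, v i + ∑ i ∈ Finset.Icc (a + 1) b, v i = ∑ i ∈ Finset.Icc 1 b, v i := by
  simpa only [← Finset.Icc_add_one_left_eq_Ioc, zero_add] using
    Finset.sum_Ioc_consecutive v a.zero_le hab

lemma sum_Icc_two_eq_sum_Icc_one {M : Type*} [AddCommMonoid M] {v : ℕ → M} (hv : v 1 = 0) (n : ℕ) :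
    ∑ i ∈ Finset.Icc 2 n, v i = ∑ i ∈ Finset.Icc 1 n, v i := by
  refine Finset.sum_subset (Finset.Icc_subset_Icc_left one_le_two) fun i hi hi' => ?_
  obtain rfl : i = 1 := by
    rw [Finset.mem_Icc] at hi hi'
    lia
  exact hv

lemma S₁_eq_sum_placement (hu : u (y 0) = 0) (hab : a ≤ b) (hb : 1 ≤ b) (hbn : b ≤ n) :
    S₁ u n y p t a b = ∑ i ∈ Finset.Icc 1 n, u (placement y t a b i) * p i := by
  have hzero : u (y (1 - 1)) * p 1 = 0 := by rw [Nat.sub_self, hu, zero_mul]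
  rw [S₁]
  split_ifs with hlt
  · rw [sum_Icc_two_eq_sum_Icc_one hzero, ← sum_Icc_one_add_sum_Icc _ hbn,
      ← sum_Icc_one_add_sum_Icc _ hab, add_assoc (Finset.sum _ _)]
    have hleft : ∑ i ∈ Finset.Icc 1 a, u (y (i - 1)) * p i
        = ∑ i ∈ Finset.Icc 1 a, u (placement y t a b i) * p i :=
      Finset.sum_congr rfl fun i hi => by rw [placement_of_le (Finset.mem_Icc.1 hi).2]
    have hmid : ∑ i ∈ Finset.Icc (a + 1) (b - 1), u (y i) * p i + u t * p b
        = ∑ i ∈ Finset.Icc (a + 1) b, u (placement y t a b i) * p i := by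
      obtain ⟨c, rfl⟩ := Nat.exists_eq_add_of_le' hb
      rw [Finset.sum_Icc_succ_top hlt, placement_self hlt, Nat.add_sub_cancel]
      congr 1
      refine Finset.sum_congr rfl fun i hi => ?_
      rw [Finset.mem_Icc] at hi
      rw [placement_of_lt_of_lt hi.1 (Nat.lt_succ_of_le hi.2)]
    have hright : ∑ i ∈ Finset.Icc (b + 1) n, u (y (i - 1)) * p i
        = ∑ i ∈ Finset.Icc (b + 1) n, u (placement y t a b i) * p i :=
      Finset.sum_congr rfl fun i hi => by rw [placement_of_gt (Finset.mem_Icc.1 hi).1]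
    rw [hleft, hmid, hright]
  · rw [sum_Icc_two_eq_sum_Icc_one hzero]
    refine Finset.sum_congr rfl fun i _ => ?_
    rw [placement, if_pos (by lia)]

lemma S₂_eq_S₁ (hj₁ : 1 ≤ j₁) (hle : j₁ ≤ j₂) :
    S₂ u n y p t j₁ j₂ = S₁ u n y p t (j₁ - 1) j₂ := by
  rw [S₁, if_pos (by lia), Nat.sub_add_cancel hj₁, S₂]
  split_ifs with hlt
  · rfl
  · obtain rfl : j₁ = j₂ := by lia
    rw [Finset.Icc_eq_empty (by lia : ¬j₁ ≤ j₁ - 1), Finset.sum_empty, add_zero]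

/-- The points `yss` and `ys` lie in the closed cells of indices `j₁ ≤ j₂`. -/
structure InCells (n : ℕ) (y : ℕ → ℝ) (ys yss : ℝ) (j₁ j₂ : ℕ) : Prop where
  one_le : 1 ≤ j₁
  le : j₁ ≤ j₂
  le_n : j₂ ≤ n
  yss_mem : yss ∈ Icc (y (j₁ - 1)) (y j₁)
  ys_mem : ys ∈ Icc (y (j₂ - 1)) (y j₂)

lemma IsPartition.exists_inCells (hy : IsPartition n y) (hyss : 0 ≤ yss) (hlt : yss < ys)
    (hys : ys ≤ 1) : ∃ j₁ j₂, InCells n y ys yss j₁ j₂ := by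
  have hcell {t : ℝ} (h0 : 0 ≤ t) (h1 : t ≤ 1) :=
    exists_mem_Icc_sub_one hy.pos (hy.zero.trans_le h0) (h1.trans_eq hy.last.symm)
  obtain ⟨j₁, hj₁, hyss_mem⟩ := hcell hyss (hlt.le.trans hys)
  obtain ⟨j₂, hj₂, hys_mem⟩ := hcell (hyss.trans hlt.le) hys
  rw [Finset.mem_Icc] at hj₁ hj₂
  refine ⟨j₁, j₂, hj₁.1, ?_, hj₂.2, hyss_mem, hys_mem⟩
  by_contra! hgt
  exact hlt.not_ge (calc
    ys ≤ y j₂ := hys_mem.2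
    _ ≤ y (j₁ - 1) := hy.le_of_le (by lia) (by lia)
    _ ≤ yss := hyss_mem.1)

lemma placement_mem_box (hy : IsPartition n y) (ht : t ∈ Icc (y (b - 1)) (y b)) :
    placement y t a b ∈ box n y := by
  intro i hi
  have hle : y (i - 1) ≤ y i := hy.le_of_le (i.sub_le 1) (Finset.mem_Icc.1 hi).2
  rw [placement]
  split_ifs with hend hlt
  · exact left_mem_Icc.2 hle
  · exact right_mem_Icc.2 hle
  · obtain rfl : i = b := by lia
    exact ht

lemma UpDownUp.apply_placement_le (hG : UpDownUp G yss ys) (hy : IsPartition n y) (hb : b ≤ n)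
    (hys : ys ∈ Icc (y (b - 1)) (y b)) (hx : x ∈ box n y) {i : ℕ} (hi : i ∈ Finset.Icc 1 n)
    (hleft : i ≤ a → x i ≤ yss) (hright : a < i → yss ≤ x i) :
    G (placement y ys a b i) ≤ G (x i) := by
  obtain ⟨h1i, hin⟩ := Finset.mem_Icc.1 hi
  have hxi := hx i hi
  have hx1 : x i ≤ 1 := (hy.mem_unit_of_mem_box hx hi).2
  have hpred : 0 ≤ y (i - 1) := (hy.mem_unit (by lia)).1
  rcases le_or_gt i a with hia | hai
  · rw [placement_of_le hia]
    exact hG.monotoneOn_left ⟨hpred, hxi.1.trans (hleft hia)⟩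
      ⟨hpred.trans hxi.1, hleft hia⟩ hxi.1
  rcases lt_trichotomy i b with hib | rfl | hbi
  · rw [placement_of_lt_of_lt hai hib]
    have hiys : y i ≤ ys := (hy.le_of_le (by lia) (by lia)).trans hys.1
    exact hG.antitoneOn_mid ⟨hright hai, hxi.2.trans hiys⟩
      ⟨(hright hai).trans hxi.2, hiys⟩ hxi.2
  · rw [placement_self hai]
    exact hG.apply_right_le (hys.2.trans (hy.mem_unit hb).2) ⟨hright hai, hx1⟩
  · rw [placement_of_gt hbi]
    have hysi : ys ≤ y (i - 1) := hys.2.trans (hy.le_of_le (by lia) (by lia))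
    exact hG.monotoneOn_right ⟨hysi, hxi.1.trans hx1⟩ ⟨hysi.trans hxi.1, hx1⟩ hxi.1

lemma UpDownUp.exists_placement_le (hG : UpDownUp G yss ys) (hy : IsPartition n y)
    (hc : InCells n y ys yss j₁ j₂) (hx : x ∈ box n y) :
    ∃ z ∈ ({placement y ys j₁ j₂, placement y ys (j₁ - 1) j₂} : Set (ℕ → ℝ)),
      ∀ i ∈ Finset.Icc 1 n, G (z i) ≤ G (x i) := by
  have hj₁n := hc.le.trans hc.le_n
  rcases le_total (x j₁) yss with hle | hge
  · refine ⟨_, Or.inl rfl, fun i hi => ?_⟩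
    obtain ⟨h1i, hin⟩ := Finset.mem_Icc.1 hi
    refine hG.apply_placement_le hy hc.le_n hc.ys_mem hx hi (fun hij => ?_) fun hji => ?_
    · exact (hy.apply_le_apply_of_mem_box hx h1i hij hj₁n).trans hle
    · calc yss ≤ y j₁ := hc.yss_mem.2
        _ ≤ y (i - 1) := hy.le_of_le (by lia) (by lia)
        _ ≤ x i := (hx i hi).1
  · refine ⟨_, Or.inr rfl, fun i hi => ?_⟩
    refine hG.apply_placement_le hy hc.le_n hc.ys_mem hx hi (fun hij => ?_) fun hji => ?_
    · calc x i ≤ y i := (hx i hi).2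
        _ ≤ y (j₁ - 1) := hy.le_of_le hij (by lia)
        _ ≤ yss := hc.yss_mem.1
    · exact hge.trans
        (hy.apply_le_apply_of_mem_box hx hc.one_le (by lia) (Finset.mem_Icc.1 hi).2)

end Placement

section FixedPoint

variable {m k r φ ys yss : ℝ} {n : ℕ} {y p : ℕ → ℝ} {j₁ j₂ : ℕ}

namespace InCells

lemma placement_mem_box (hc : InCells n y ys yss j₁ j₂) (hy : IsPartition n y) (a : ℕ) :
    placement y ys a j₂ ∈ box n y :=
  CBI.placement_mem_box hy hc.ys_mem

lemma φ₁_eq (hc : InCells n y ys yss j₁ j₂) (hr : r ≠ 0) (hy : IsPartition n y) :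
    φ₁ m k r n y p ys j₁ j₂ = objective m k r n p (placement y ys j₁ j₂) := by
  have hS (k' : ℝ) : S₁ (g k' r) n y p ys j₁ j₂ = den k' r n p (placement y ys j₁ j₂) :=
    S₁_eq_sum_placement (by rw [hy.zero, g_zero hr]) hc.le (hc.one_le.trans hc.le) hc.le_n
  exact congrArg₂ (· / ·) (hS (m + k)) (hS k)

lemma φ₂_eq (hc : InCells n y ys yss j₁ j₂) (hr : r ≠ 0) (hy : IsPartition n y) :
    φ₂ m k r n y p ys j₁ j₂ = objective m k r n p (placement y ys (j₁ - 1) j₂) := by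
  have hS (k' : ℝ) : S₂ (g k' r) n y p ys j₁ j₂ = den k' r n p (placement y ys (j₁ - 1) j₂) :=
    (S₂_eq_S₁ hc.one_le hc.le).trans
      (S₁_eq_sum_placement (by rw [hy.zero, g_zero hr]) ((j₁.sub_le 1).trans hc.le)
        (hc.one_le.trans hc.le) hc.le_n)
  exact congrArg₂ (· / ·) (hS (m + k)) (hS k)

end InCells

lemma isLeast_objective_box_iff (hm : 0 < m) (hk : 0 ≤ k) (hr : 0 < r) (hy : IsPartition n y)
    (hp : ∀ i ∈ Finset.Icc 1 n, 0 < p i) (hn : 3 ≤ n) (hcrit : IsCriticalPair m k r φ ys yss)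
    (hc : InCells n y ys yss j₁ j₂) :
    IsLeast (objective m k r n p '' box n y) φ ↔
      φ = min (φ₁ m k r n y p ys j₁ j₂) (φ₂ m k r n y p ys j₁ j₂) := by
  set t : Set (ℕ → ℝ) := {placement y ys j₁ j₂, placement y ys (j₁ - 1) j₂}
  have hts : t ⊆ box n y := insert_subset (hc.placement_mem_box hy _)
    (singleton_subset_iff.2 (hc.placement_mem_box hy _))
  have hden (x) (hx : x ∈ box n y) : 0 < den k r n p x := den_pos hy hp hn hx
  have hdom (x) (hx : x ∈ box n y) : ∃ z ∈ t,
      num m k r n p z - φ * den k r n p z ≤ num m k r n p x - φ * den k r n p x := by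
    obtain ⟨z, hz, hzx⟩ := (hcrit.upDownUp_excess hm hk hr).exists_placement_le hy hc hx
    refine ⟨z, hz, ?_⟩
    rw [← sum_excess, ← sum_excess]
    exact Finset.sum_le_sum fun i hi => mul_le_mul_of_nonneg_right (hzx i hi) (hp i hi).le
  calc IsLeast (objective m k r n p '' box n y) φ
      ↔ IsLeast ((fun x => num m k r n p x - φ * den k r n p x) '' box n y) 0 :=
        isLeast_div_image_iff hden
    _ ↔ IsLeast ((fun x => num m k r n p x - φ * den k r n p x) '' t) 0 :=
        (isLeast_image_iff_of_subset hts hdom).symm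
    _ ↔ IsLeast (objective m k r n p '' t) φ :=
        (isLeast_div_image_iff fun x hx => hden x (hts hx)).symm
    _ ↔ φ = min (φ₁ m k r n y p ys j₁ j₂) (φ₂ m k r n y p ys j₁ j₂) := by
        rw [image_pair, ← hc.φ₁_eq hr.ne' hy, ← hc.φ₂_eq hr.ne' hy,
          isLeast_pair.isLeast_iff_eq, eq_comm]

lemma isFixedPoint_iff (hm : 0 < m) (hk : 0 ≤ k) (hr : 0 < r) (hy : IsPartition n y)
    (hp : ∀ i ∈ Finset.Icc 1 n, 0 < p i) (hn : 3 ≤ n) :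
    IsFixedPoint m k r n y p φ ys yss j₁ j₂ ↔
      IsCriticalPair m k r φ ys yss ∧ InCells n y ys yss j₁ j₂ ∧
        IsLeast (objective m k r n p '' box n y) φ := by
  constructor
  · intro hf
    have hj₁ : j₁ ∈ Finset.Icc 1 n := Finset.mem_Icc.2 ⟨hf.one_le, hf.le.trans hf.le_n⟩
    have hj₂ : j₂ ∈ Finset.Icc 1 n := Finset.mem_Icc.2 ⟨hf.one_le.trans hf.le, hf.le_n⟩
    have hc : InCells n y ys yss j₁ j₂ := ⟨hf.one_le, hf.le, hf.le_n,
      hy.closure_I hj₁ ▸ hf.yss_mem, hy.closure_I hj₂ ▸ hf.ys_mem⟩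
    have hcrit : IsCriticalPair m k r φ ys yss :=
      ⟨(hy.mem_unit ((j₁.sub_le 1).trans (hc.le.trans hc.le_n))).1.trans hc.yss_mem.1,
        hc.ys_mem.2.trans (hy.mem_unit hc.le_n).2, hf.h_yss, hf.h_ys, hf.yss_lt, hf.lt_ys⟩
    exact ⟨hcrit, hc, (isLeast_objective_box_iff hm hk hr hy hp hn hcrit hc).2 hf.eq_min⟩
  · rintro ⟨hcrit, hc, hφ⟩
    have hj₁ : j₁ ∈ Finset.Icc 1 n := Finset.mem_Icc.2 ⟨hc.one_le, hc.le.trans hc.le_n⟩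
    have hj₂ : j₂ ∈ Finset.Icc 1 n := Finset.mem_Icc.2 ⟨hc.one_le.trans hc.le, hc.le_n⟩
    exact ⟨hc.one_le, hc.le, hc.le_n, hcrit.h_yss, hcrit.h_ys,
      (isLeast_objective_box_iff hm hk hr hy hp hn hcrit hc).1 hφ, hcrit.yss_lt,
      div_add_add_lt_div_add hm hk hr, hcrit.lt_ys, (hy.closure_I hj₁).symm ▸ hc.yss_mem,
      (hy.closure_I hj₂).symm ▸ hc.ys_mem⟩

end FixedPoint

section Loc

variable {m k r φ ys yss : ℝ} {n : ℕ} {y p : ℕ → ℝ} {j₁ j₂ : ℕ}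

lemma loc_eqOn_placement (hy : IsPartition n y) (hn : n ≠ 1) (hj₁ : 1 ≤ j₁)
    (hφ : φ = φ₁ m k r n y p ys j₁ j₂) :
    EqOn (loc m k r n y p φ ys j₁ j₂) (placement y ys j₁ j₂) (Finset.Icc 1 n) := by
  intro i hi
  have h1i := (Finset.mem_Icc.1 hi).1
  rw [loc, if_pos hφ, placement]
  rcases h1i.eq_or_lt with rfl | hlt
  · rw [if_pos rfl, if_neg hn, if_pos (Or.inl hj₁), Nat.sub_self, hy.zero]
  · split_ifs <;> first | rfl | lia

lemma loc_eqOn_placement_sub_one (hy : IsPartition n y) (hn : n ≠ 1)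
    (hc : InCells n y ys yss j₁ j₂) (hj₁ : j₁ ≠ 1) (hφ : φ ≠ φ₁ m k r n y p ys j₁ j₂) :
    EqOn (loc m k r n y p φ ys j₁ j₂) (placement y ys (j₁ - 1) j₂) (Finset.Icc 1 n) := by
  intro i hi
  have h1i := (Finset.mem_Icc.1 hi).1
  obtain ⟨hone, hle, hle_n, -, hys_mem⟩ := hc
  have hmin : min (y j₁) ys = if j₁ < j₂ then y j₁ else ys := by
    split_ifs with hlt
    · exact min_eq_left ((hy.le_of_le (by lia) (by lia)).trans hys_mem.1)
    · obtain rfl : j₁ = j₂ := by lia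
      exact min_eq_right hys_mem.2
  rw [loc, if_neg hφ, placement, hmin]
  rcases h1i.eq_or_lt with rfl | hlt
  · rw [if_pos rfl, if_neg hn, if_pos (Or.inl (by lia)), Nat.sub_self, hy.zero]
  · split_ifs <;> first | rfl | lia

lemma objective_placement_one_le {b : ℕ} (hm : 0 ≤ m) (hk : 0 ≤ k) (hr : r ≠ 0)
    (hy : IsPartition n y) (hp : ∀ i ∈ Finset.Icc 1 n, 0 < p i) (hn : 3 ≤ n)
    (hys : ys ∈ Icc (y (b - 1)) (y b)) :
    objective m k r n p (placement y ys 1 b) ≤ objective m k r n p (placement y ys 0 b) := by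
  have hbox (a : ℕ) : placement y ys a b ∈ box n y := placement_mem_box hy hys
  have hden (a : ℕ) : 0 < den k r n p (placement y ys a b) := den_pos hy hp hn (hbox a)
  set φ := objective m k r n p (placement y ys 0 b) with hφ
  have hsum₀ : ∑ i ∈ Finset.Icc 1 n, excess m k r φ (placement y ys 0 b i) * p i = 0 := by
    rw [sum_excess, sub_eq_zero]
    exact ((eq_div_iff (hden 0).ne').1 hφ).symm
  have hfirst : 0 ≤ excess m k r φ (placement y ys 0 b 1) :=
    excess_first_nonneg hm hk hy hp (hbox 0) hsum₀.ge
  have hexcess (i) (hi : i ∈ Finset.Icc 1 n) :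
      excess m k r φ (placement y ys 1 b i) ≤ excess m k r φ (placement y ys 0 b i) := by
    rcases (Finset.mem_Icc.1 hi).1.eq_or_lt with rfl | hlt
    · rwa [placement_of_le le_rfl, Nat.sub_self, hy.zero, excess_zero hr]
    · have hsame : placement y ys 1 b i = placement y ys 0 b i := by
        simp only [placement, hlt.not_ge, (zero_lt_one.trans hlt).not_ge]
      rw [hsame]
  have hsum₁ : ∑ i ∈ Finset.Icc 1 n, excess m k r φ (placement y ys 1 b i) * p i ≤ 0 :=
    hsum₀ ▸ Finset.sum_le_sum fun i hi => mul_le_mul_of_nonneg_right (hexcess i hi) (hp i hi).le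
  rw [sum_excess, sub_nonpos] at hsum₁
  exact (div_le_iff₀ (hden 1)).2 hsum₁

lemma InCells.φ₁_le_φ₂_of_first (hc : InCells n y ys yss 1 j₂) (hm : 0 ≤ m) (hk : 0 ≤ k)
    (hr : r ≠ 0) (hy : IsPartition n y) (hp : ∀ i ∈ Finset.Icc 1 n, 0 < p i) (hn : 3 ≤ n) :
    φ₁ m k r n y p ys 1 j₂ ≤ φ₂ m k r n y p ys 1 j₂ := by
  rw [hc.φ₁_eq hr hy, hc.φ₂_eq hr hy]
  exact objective_placement_one_le hm hk hr hy hp hn hc.ys_mem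

namespace IsFixedPoint

lemma exists_loc_eqOn (hf : IsFixedPoint m k r n y p φ ys yss j₁ j₂) (hm : 0 < m) (hk : 0 ≤ k)
    (hr : 0 < r) (hy : IsPartition n y) (hp : ∀ i ∈ Finset.Icc 1 n, 0 < p i) (hn : 3 ≤ n) :
    ∃ z ∈ box n y, EqOn (loc m k r n y p φ ys j₁ j₂) z (Finset.Icc 1 n) ∧
      objective m k r n p z = φ := by
  obtain ⟨-, hc, -⟩ := (isFixedPoint_iff hm hk hr hy hp hn).1 hf
  by_cases hφ : φ = φ₁ m k r n y p ys j₁ j₂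
  · exact ⟨_, hc.placement_mem_box hy _,
      loc_eqOn_placement hy (by lia) hc.one_le hφ,
      (hc.φ₁_eq hr.ne' hy).symm.trans hφ.symm⟩
  · have hφ₂ : φ = φ₂ m k r n y p ys j₁ j₂ := hf.eq_min.trans
      ((min_choice _ _).resolve_left fun hmin => hφ (hf.eq_min.trans hmin))
    have hj₁ : j₁ ≠ 1 := by
      rintro rfl
      exact hφ (hf.eq_min.trans
        (min_eq_left (hc.φ₁_le_φ₂_of_first hm.le hk hr.ne' hy hp hn)))
    exact ⟨_, hc.placement_mem_box hy _,
      loc_eqOn_placement_sub_one hy (by lia) hc hj₁ hφ,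
      (hc.φ₂_eq hr.ne' hy).symm.trans hφ₂.symm⟩

lemma loc_mem_box (hf : IsFixedPoint m k r n y p φ ys yss j₁ j₂) (hm : 0 < m) (hk : 0 ≤ k)
    (hr : 0 < r) (hy : IsPartition n y) (hp : ∀ i ∈ Finset.Icc 1 n, 0 < p i) (hn : 3 ≤ n) :
    loc m k r n y p φ ys j₁ j₂ ∈ box n y := by
  obtain ⟨z, hz, hloc, -⟩ := hf.exists_loc_eqOn hm hk hr hy hp hn
  exact fun i hi => (hloc hi).symm ▸ hz i hi

lemma objective_loc (hf : IsFixedPoint m k r n y p φ ys yss j₁ j₂) (hm : 0 < m) (hk : 0 ≤ k)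
    (hr : 0 < r) (hy : IsPartition n y) (hp : ∀ i ∈ Finset.Icc 1 n, 0 < p i) (hn : 3 ≤ n) :
    objective m k r n p (loc m k r n y p φ ys j₁ j₂) = φ := by
  obtain ⟨z, -, hloc, hz⟩ := hf.exists_loc_eqOn hm hk hr hy hp hn
  exact (objective_congr hloc).trans hz

end IsFixedPoint

end Loc

section DiscreteMeasure

variable {ι α : Type*} [MeasurableSpace α] {s : Finset ι} {p : ι → ℝ}

lemma isProbabilityMeasure_sum_smul_dirac (hp : ∀ i ∈ s, 0 ≤ p i) (hsum : ∑ i ∈ s, p i = 1)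
    (x : ι → α) : IsProbabilityMeasure (∑ i ∈ s, ENNReal.ofReal (p i) • Measure.dirac (x i)) := by
  constructor
  simp only [Measure.finsetSum_apply, Measure.smul_apply, measure_univ, smul_eq_mul, mul_one]
  rw [← ENNReal.ofReal_sum_of_nonneg hp, hsum, ENNReal.ofReal_one]

lemma integral_sum_smul_dirac [MeasurableSingletonClass α] {E : Type*} [NormedAddCommGroup E]
    [NormedSpace ℝ E] [CompleteSpace E] (hp : ∀ i ∈ s, 0 ≤ p i) (x : ι → α) (u : α → E) :
    ∫ t, u t ∂(∑ i ∈ s, ENNReal.ofReal (p i) • Measure.dirac (x i)) = ∑ i ∈ s, p i • u (x i) := by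
  rw [integral_finsetSum_measure fun i _ =>
    (integrable_dirac enorm_lt_top).smul_measure ENNReal.ofReal_ne_top]
  refine Finset.sum_congr rfl fun i hi => ?_
  rw [integral_smul_measure, integral_dirac, ENNReal.toReal_ofReal (hp i hi)]

end DiscreteMeasure

section Prior

variable {m k r φ ys : ℝ} {n : ℕ} {y p : ℕ → ℝ} {j₁ j₂ : ℕ}

lemma integral_prior (hp : ∀ i ∈ Finset.Icc 1 n, 0 ≤ p i) (u : ℝ → ℝ) :
    ∫ x, u x ∂(prior m k r n y p φ ys j₁ j₂)
      = ∑ i ∈ Finset.Icc 1 n, u (loc m k r n y p φ ys j₁ j₂ i) * p i := by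
  rw [prior, integral_sum_smul_dirac hp]
  simp only [smul_eq_mul, mul_comm]

end Prior

section Degenerate

variable {m k r t : ℝ} {n : ℕ} {y p : ℕ → ℝ}

lemma sum_comp_single_mul {u : ℝ → ℝ} (hu : u 0 = 0) (hn : 1 ≤ n) :
    ∑ i ∈ Finset.Icc 1 n, u (if i = n then t else 0) * p i = u t * p n := by
  rw [Finset.sum_eq_single_of_mem n (Finset.mem_Icc.2 ⟨hn, le_rfl⟩), if_pos rfl]
  intro i _ hi
  rw [if_neg hi, hu, zero_mul]

lemma den_single (hr : r ≠ 0) (hn : 1 ≤ n) :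
    den k r n p (fun i => if i = n then t else 0) = g k r t * p n :=
  sum_comp_single_mul (g_zero hr) hn

lemma objective_single (hm : 0 ≤ m) (hk : 0 ≤ k) (hr : r ≠ 0) (hn : 1 ≤ n) (hpn : p n ≠ 0)
    (ht : t ∈ Ioo (0 : ℝ) 1) :
    objective m k r n p (fun i => if i = n then t else 0) = (1 - t) ^ m := by
  rw [objective, num_eq_den, den_single hr hn, den_single hr hn, ← f_eq_g,
    f_eq_rpow_mul_g hm hk ht.2.le, mul_assoc, mul_div_cancel_right₀ _
      (mul_ne_zero (g_pos ht).ne' hpn)]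

lemma tendsto_objective_single (hm : 0 < m) (hk : 0 ≤ k) (hr : r ≠ 0) (hn : 1 ≤ n)
    (hpn : p n ≠ 0) :
    Tendsto (fun t : ℝ => objective m k r n p (fun i => if i = n then t else 0))
      (𝓝[<] 1) (𝓝 0) := by
  have hcont : Continuous fun t : ℝ => (1 - t) ^ m :=
    (continuous_const.sub continuous_id).rpow_const fun _ => Or.inr hm.le
  have hlim : Tendsto (fun t : ℝ => (1 - t) ^ m) (𝓝[<] 1) (𝓝 0) :=
    (hcont.tendsto' 1 0 (by rw [sub_self, Real.zero_rpow hm.ne'])).mono_left nhdsWithin_le_nhds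
  refine hlim.congr' ?_
  filter_upwards [Ioo_mem_nhdsLT (zero_lt_one' ℝ)] with t ht
  exact (objective_single hm.le hk hr hn hpn ht).symm

lemma objective_nonneg_of_mem_box {x : ℕ → ℝ} (hy : IsPartition n y)
    (hp : ∀ i ∈ Finset.Icc 1 n, 0 ≤ p i) (hx : x ∈ box n y) : 0 ≤ objective m k r n p x := by
  have hden (k' : ℝ) : 0 ≤ den k' r n p x := Finset.sum_nonneg fun i hi =>
    mul_nonneg (g_nonneg (hy.mem_unit_of_mem_box hx hi)) (hp i hi)
  exact div_nonneg (hden (m + k)) (hden k)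

lemma single_mem_I (hy : IsPartition n y) (hn : n ≤ 2) (ht : t ∈ Ioo (y (n - 1)) 1) {i : ℕ}
    (hi : i ∈ Finset.Icc 1 n) : (if i = n then t else 0) ∈ I y i := by
  rw [Finset.mem_Icc] at hi
  split_ifs with hin
  · subst hin
    have hmem : t ∈ Ioc (y (i - 1)) (y i) := ⟨ht.1, ht.2.le.trans_eq hy.last.symm⟩
    unfold I
    split_ifs with h1
    · subst h1
      exact Ioc_subset_Icc_self hmem
    · exact hmem
  · obtain rfl : i = 1 := by lia
    rw [I, if_pos rfl]
    exact ⟨hy.zero.le, (hy.mem_unit hi.2).1⟩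

lemma isGLB_values_zero (hm : 0 < m) (hk : 0 ≤ k) (hr : r ≠ 0) (hy : IsPartition n y)
    (hp : ∀ i ∈ Finset.Icc 1 n, 0 < p i) (hn : n ≤ 2) : IsGLB (values m k r n y p) 0 := by
  have hpn : 0 < p n := hp n (Finset.mem_Icc.2 ⟨hy.pos, le_rfl⟩)
  have hlast : y (n - 1) < 1 := hy.last ▸ hy.lt_of_lt (Nat.sub_one_lt hy.pos.ne') le_rfl
  refine isGLB_of_mem_closure ?_ <| mem_closure_of_tendsto
    (tendsto_objective_single hm hk hr hy.pos hpn.ne') ?_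
  · rintro v ⟨x, hx, -, rfl⟩
    exact objective_nonneg_of_mem_box hy (fun i hi => (hp i hi).le)
      (hy.closure_pi_I ▸ subset_closure hx)
  · filter_upwards [Ioo_mem_nhdsLT hlast] with t ht
    have ht0 : 0 < t := (hy.mem_unit (n.sub_le 1)).1.trans_lt ht.1
    refine ⟨_, fun i hi => single_mem_I hy hn ht hi, ?_, rfl⟩
    rw [den_single hr hy.pos]
    exact (mul_pos (g_pos ⟨ht0, ht.2⟩) hpn).ne'

end Degenerate

end CBI

theorem theorem1 (m k r : ℝ) (hm : 0 < m) (hk : 0 < k) (hr : 0 < r)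
    (n : ℕ) (y p : ℕ → ℝ)
    (hy0 : y 0 = 0) (hyn : y n = 1) (hy : ∀ i < n, y i < y (i + 1))
    (hp : ∀ i ∈ Finset.Icc 1 n, 0 < p i) (hp1 : ∑ i ∈ Finset.Icc 1 n, p i = 1) :
    (3 ≤ n →
      ∃ φ ys yss : ℝ,
        -- the triple solves the fixed-point system
        (∃ j₁ j₂ : ℕ, CBI.IsFixedPoint m k r n y p φ ys yss j₁ j₂) ∧
        -- it is the only triple that does
        (∀ (φ' ys' yss' : ℝ) (j₁ j₂ : ℕ), CBI.IsFixedPoint m k r n y p φ' ys' yss' j₁ j₂ →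
          φ' = φ ∧ ys' = ys ∧ yss' = yss) ∧
        -- its first component is the infimum
        IsGLB (CBI.values m k r n y p) φ ∧
        -- the infimum is attained by the conservative prior, a limit of feasible ones
        (∀ j₁ j₂ : ℕ, CBI.IsFixedPoint m k r n y p φ ys yss j₁ j₂ →
          (∀ i ∈ Finset.Icc 1 n, CBI.loc m k r n y p φ ys j₁ j₂ i ∈ closure (CBI.I y i)) ∧
          IsProbabilityMeasure (CBI.prior m k r n y p φ ys j₁ j₂) ∧
          0 < ∫ x, CBI.g k r x ∂(CBI.prior m k r n y p φ ys j₁ j₂) ∧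
          (∫ x, CBI.f m k r x ∂(CBI.prior m k r n y p φ ys j₁ j₂)) /
            (∫ x, CBI.g k r x ∂(CBI.prior m k r n y p φ ys j₁ j₂)) = φ)) ∧
    -- the degenerate cases `n = 1, 2`: the infimum is `0`, approached as `x_n → 1`
    (n ≤ 2 →
      IsGLB (CBI.values m k r n y p) 0 ∧
      CBI.h m k r (r / (r + m + k)) = 0 ∧ CBI.h m k r 1 = 0 ∧
      Tendsto (fun t : ℝ => CBI.objective m k r n p (fun i => if i = n then t else 0))
        (𝓝[<] 1) (𝓝 0)) := by
  have hP : CBI.IsPartition n y := ⟨hy0, hyn, strictMonoOn_Iic_of_lt_succ hy⟩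
  have hp' : ∀ i ∈ Finset.Icc 1 n, 0 ≤ p i := fun i hi => (hp i hi).le
  refine ⟨fun hn => ?_, fun hn => ?_⟩
  · obtain ⟨φ, hφ⟩ := CBI.exists_isLeast_objective_box hm.le hk.le hr.le hP hp hn
    have hφ01 : φ ∈ Ioo 0 1 :=
      image_subset_iff.2 (fun _ => CBI.objective_mem_Ioo hm hk.le hP hp hn) hφ.1
    obtain ⟨ys, yss, hcrit⟩ := CBI.exists_isCriticalPair hm hk hr hφ01
    obtain ⟨j₁, j₂, hcells⟩ := hP.exists_inCells hcrit.nonneg (hcrit.lt hm hk.le hr) hcrit.le_one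
    refine ⟨φ, ys, yss, ⟨j₁, j₂, ?_⟩, fun φ' ys' yss' i₁ i₂ hf => ?_,
      CBI.isGLB_values hm.le hk.le hr.le hP hp hn hφ, fun i₁ i₂ hf => ?_⟩
    · exact (CBI.isFixedPoint_iff hm hk.le hr hP hp hn).2 ⟨hcrit, hcells, hφ⟩
    · obtain ⟨hcrit', -, hφ'⟩ := (CBI.isFixedPoint_iff hm hk.le hr hP hp hn).1 hf
      obtain rfl := hφ.unique hφ'
      exact ⟨rfl, hcrit.unique hcrit' hm hk.le hr⟩
    · have hbox := hf.loc_mem_box hm hk.le hr hP hp hn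
      refine ⟨fun i hi => hP.closure_I hi ▸ hbox i hi,
        CBI.isProbabilityMeasure_sum_smul_dirac hp' hp1 _, ?_, ?_⟩
      · exact (CBI.integral_prior hp' _).symm ▸ CBI.den_pos hP hp hn hbox
      · rw [CBI.integral_prior hp', CBI.integral_prior hp']
        exact hf.objective_loc hm hk.le hr hP hp hn
  · have hpn : p n ≠ 0 := (hp n (Finset.mem_Icc.2 ⟨hP.pos, le_rfl⟩)).ne'
    exact ⟨CBI.isGLB_values_zero hm hk.le hr.ne' hP hp hn, CBI.h_div_add_add (by positivity),
      CBI.h_one hm.ne', CBI.tendsto_objective_single hm hk.le hr.ne' hP.pos hpn⟩
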